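/- Let $G=(V,E)$ be a finite undirected simple graph, let $N(v)$ be the set of neighbours of a vertex $v$, let $C$ be a connected component of $G$ (so $C=V$ if $G$ is connected), and let $f:V\to\mathbb R$ be any function. A *simple random walk* (SRW) is a process $X_0,X_1,X_2,\dots$ in $V$ such that, given $X_0,\dots,X_t$, the vertex $X_{t+1}$ is uniformly distributed on $N(X_t)$. A *circulated neighbors random walk* (CNRW) is a process $X'_0,X'_1,X'_2,\dots$ in $V$ that starts with a (possibly random) transition $X'_0\to X'_1$ along an edge and keeps, for every directed edge $u\to v$, a set $b(u,v)\subseteq N(v)$, with all these sets empty at the start; whenever its last transition is $X'_{t-1}=u\to X'_t=v$ ($t\ge 1$), the next vertex $w=X'_{t+1}$ is chosen, given the whole past, uniformly from $N(v)\setminus b(u,v)$, then $b(u,v)$ is replaced by $b(u,v)\cup\{w\}$, and, if this set is now equal to $N(v)$, $b(u,v)$ is reset to $\emptyset$. Put $$\hat\mu_n=\frac1n\sum_{t=1}^n f(X_t),\qquad \hat\mu'_n=\frac1n\sum_{t=1}^n f(X'_t).$$ Then the asymptotic variances $$V_\infty(\hat\mu)=\lim_{n\to\infty} n\,\mathrm{Var}(\hat\mu_n),\qquad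 V_\infty(\hat\mu')=\lim_{n\to\infty} n\,\mathrm{Var}(\hat\mu'_n)$$ exist and are finite for every SRW, respectively every CNRW, that starts in $C$; they depend only on $G$, $C$ and $f$, and not on the law of the start of the walk inside $C$; and $$V_\infty(\hat\mu')\le V_\infty(\hat\mu).$$ -/

import Mathlib

open MeasureTheory ProbabilityTheory Filter Topology

/-- One-step transition probability of the simple random walk on `G`, from `v` to `w`:
`1 / deg v` if `w` is a neighbour of `v`, and `0` otherwise. -/
noncomputable def srwStep {V : Type*} [Fintype V] (G : SimpleGraph V) [DecidableRel G.Adj]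
    (v w : V) : ℝ :=
  if G.Adj v w then 1 / (G.degree v : ℝ) else 0

/-- The process `X 0, X 1, …` is a simple random walk on `G` under `P`, with an arbitrary law of
`X 0`: given the whole past `X 0 = x 0, …, X n = x n`, the next vertex is a uniformly chosen
neighbour of `x n`. (The conditional probability is cleared of its denominator.) -/
structure IsSRW {V : Type*} [Fintype V] [MeasurableSpace V]
    (G : SimpleGraph V) [DecidableRel G.Adj]
    {Ω : Type*} [MeasurableSpace Ω] (P : Measure Ω) (X : ℕ → Ω → V) : Prop where
  measurable : ∀ t, Measurable (X t)
  step : ∀ (n : ℕ) (x : ℕ → V),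
    P.real {ω | ∀ i ≤ n + 1, X i ω = x i} =
      P.real {ω | ∀ i ≤ n, X i ω = x i} * srwStep G (x n) (x (n + 1))

/-- The memory of the circulated neighbors random walk: `cnrwMemory G x n u v` is the set `b(u,v)`
of those neighbours of `v` that are currently excluded after the transition `u → v`, once the
vertices `x 0, …, x n` have been visited. All sets are empty at the start. When `w` is visited
directly after `u → v`, it is added to `b(u,v)`, and `b(u,v)` is reset to `∅` as soon as it is all
of `N(v)`. -/
def cnrwMemory {V : Type*} [Fintype V] [DecidableEq V] (G : SimpleGraph V) [DecidableRel G.Adj]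
    (x : ℕ → V) : ℕ → V → V → Finset V
  | 0 => fun _ _ => ∅
  | 1 => fun _ _ => ∅
  | n + 2 => fun u v =>
      if u = x n ∧ v = x (n + 1) then
        if insert (x (n + 2)) (cnrwMemory G x (n + 1) u v) = G.neighborFinset v then ∅
        else insert (x (n + 2)) (cnrwMemory G x (n + 1) u v)
      else cnrwMemory G x (n + 1) u v

/-- The set `N(v) \ b(u,v)` of candidates for the step at time `n + 2`, where `u → v` is the last
transition `x n → x (n + 1)` and the memory is that of the history `x 0, …, x (n + 1)`. -/
def cnrwCandidates {V : Type*} [Fintype V] [DecidableEq V] (G : SimpleGraph V)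
    [DecidableRel G.Adj] (x : ℕ → V) (n : ℕ) : Finset V :=
  G.neighborFinset (x (n + 1)) \ cnrwMemory G x (n + 1) (x n) (x (n + 1))

/-- Probability that the circulated neighbors random walk with history `x 0, …, x (n + 1)` moves
to `w` next: uniform on the set of candidates. -/
noncomputable def cnrwStep {V : Type*} [Fintype V] [DecidableEq V] (G : SimpleGraph V)
    [DecidableRel G.Adj] (x : ℕ → V) (n : ℕ) (w : V) : ℝ :=
  if w ∈ cnrwCandidates G x n then 1 / ((cnrwCandidates G x n).card : ℝ) else 0

/-- The process `X 0, X 1, …` is a circulated neighbors random walk (CNRW) on `G` under `P`. The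
initial transition `X 0 → X 1` is an arbitrary (possibly random) transition along an edge;
from then on, given the whole past, the next vertex is uniform on the candidates `N(v) \ b(u,v)`,
where `u → v` is the last transition. -/
structure IsCNRW {V : Type*} [Fintype V] [DecidableEq V] [MeasurableSpace V]
    (G : SimpleGraph V) [DecidableRel G.Adj]
    {Ω : Type*} [MeasurableSpace Ω] (P : Measure Ω) (X : ℕ → Ω → V) : Prop where
  measurable : ∀ t, Measurable (X t)
  adj : ∀ᵐ ω ∂P, G.Adj (X 0 ω) (X 1 ω)
  step : ∀ (n : ℕ) (x : ℕ → V),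
    P.real {ω | ∀ i ≤ n + 2, X i ω = x i} =
      P.real {ω | ∀ i ≤ n + 1, X i ω = x i} * cnrwStep G x n (x (n + 2))

/-- The empirical mean `(1/n) ∑_{t=1}^n f (X t)`. -/
noncomputable def empiricalMean {V Ω : Type*} (f : V → ℝ) (X : ℕ → Ω → V) (n : ℕ) (ω : Ω) : ℝ :=
  (1 / (n : ℝ)) * ∑ t ∈ Finset.Icc 1 n, f (X t ω)

/-- The empirical-mean estimator of `f` along `X` has asymptotic variance `s`: the limit of
`n * Var` exists, is finite, and equals `s`. -/
def HasAsymptoticVariance {V Ω : Type*} [MeasurableSpace Ω] (P : Measure Ω) (X : ℕ → Ω → V)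
    (f : V → ℝ) (s : ℝ) : Prop :=
  Tendsto (fun n : ℕ => (n : ℝ) * variance (empiricalMean f X n) P) atTop (𝓝 s)

/-! Let `P` be the kernel of the simple random walk. On `C` the Poisson equation `f - m = g - P g`
has a solution, so along any path in `C` the centred sum of `f` is a bounded boundary term plus the
sum of the increments `φ(v, w) = g w - (P g) v` over the steps `v → w`.

For the CNRW, `φ(v, ·)` sums to zero over `N(v)`. Each completed circulation after an edge `u → v`
therefore cancels, and only the sum of `φ` over the current memory remains
(`sum_range_eq_sum_cnrwMemory`). The memory has finitely many states, so the centred sums are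
uniformly bounded and the asymptotic variance is 0, whatever `f` is.

For the SRW the increments form a martingale, whose variance is the expected sum of the one-step
variances. A second Poisson equation, for the one-step variance, evaluates that expectation as `n *
c + O(1)`, while the boundary term changes the variance by only `O(√n)`. The asymptotic variance is
thus `c`, a mean of a nonnegative function, and the inequality reduces to `0 ≤ c`. No aperiodicity
is needed. -/

/-! ### The Poisson equation -/

/-- The range of the Laplacian contains every function orthogonal to the functions that are constant
on connected components. -/
theorem exists_lapMatrix_mulVec_eq {V : Type*} [Fintype V] [DecidableEq V] (G : SimpleGraph V)
    [DecidableRel G.Adj] (a : V → ℝ)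
    (ha : ∀ z : V → ℝ, (∀ i j, G.Reachable i j → z i = z j) → ∑ v, a v * z v = 0) :
    ∃ g : V → ℝ, (G.lapMatrix ℝ).mulVec g = a := by
  have hsymm : (Matrix.toEuclideanLin (G.lapMatrix ℝ)).IsSymmetric :=
    Matrix.isSymmetric_toEuclideanLin_iff.2 (G.posSemidef_lapMatrix ℝ).1
  have hmem : WithLp.toLp 2 a ∈ LinearMap.range (Matrix.toEuclideanLin (G.lapMatrix ℝ)) := by
    -- For a symmetric operator in finite dimension, the range is the orthogonal complement of the
    -- kernel.
    rw [← Submodule.orthogonal_orthogonal (LinearMap.range _), hsymm.orthogonal_range,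
      Submodule.mem_orthogonal]
    intro z hz
    have hz' : (G.lapMatrix ℝ).mulVec z.ofLp = 0 := by
      simpa using congrArg WithLp.ofLp (LinearMap.mem_ker.1 hz)
    have := ha z.ofLp (G.lapMatrix_mulVec_eq_zero_iff_forall_reachable.1 hz')
    simpa [PiLp.inner_apply] using this
  obtain ⟨g, hg⟩ := hmem
  exact ⟨g.ofLp, by simpa using congrArg WithLp.ofLp hg⟩

/-- Solution of the Poisson equation of the simple random walk on a connected component. -/
theorem exists_poisson {V : Type*} [Fintype V] [DecidableEq V] (G : SimpleGraph V)
    [DecidableRel G.Adj] (C : G.ConnectedComponent) (h : V → ℝ) :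
    ∃ (g : V → ℝ) (c : ℝ), (∀ v ∈ C.supp, h v - c = g v - ∑ w, srwStep G v w * g w) ∧
      ((∀ v, 0 ≤ h v) → 0 ≤ c) := by
  classical
  by_cases hdeg : ∀ v ∈ C.supp, 0 < G.degree v
  · set d : V → ℝ := fun v => if v ∈ C.supp then (G.degree v : ℝ) else 0 with hd
    have hd0 : ∀ v, 0 ≤ d v := fun v => by simp only [hd]; split_ifs <;> positivity
    obtain ⟨v₀, hv₀⟩ := C.nonempty_supp
    have hpos : 0 < ∑ v, d v :=
      Finset.sum_pos' (fun v _ => hd0 v) ⟨v₀, Finset.mem_univ _, by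
        simp only [hd, if_pos hv₀]; exact_mod_cast hdeg v₀ hv₀⟩
    -- Multiplying by the degree turns `I - P` into the Laplacian on `C`; `c`, the stationary mean
    -- of `h`, makes the right-hand side orthogonal to its kernel.
    set c : ℝ := (∑ v, d v * h v) / ∑ v, d v with hc
    obtain ⟨g, hg⟩ := exists_lapMatrix_mulVec_eq G (fun v => d v * (h v - c)) (by
      intro z hz
      have : ∀ v, d v * (h v - c) * z v = (d v * h v - d v * c) * z v₀ := by
        intro v
        by_cases hv : v ∈ C.supp
        · rw [hz v v₀ (SimpleGraph.ConnectedComponent.exact (hv.trans hv₀.symm))]; ring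
        · have : d v = 0 := if_neg hv
          simp [this]
      simp_rw [this]
      rw [← Finset.sum_mul, Finset.sum_sub_distrib, ← Finset.sum_mul, hc,
        mul_div_cancel₀ _ hpos.ne', sub_self, zero_mul])
    refine ⟨g, c, fun v hv => ?_, fun hh =>
      div_nonneg (Finset.sum_nonneg fun v _ => mul_nonneg (hd0 v) (hh v)) hpos.le⟩
    have hv' : (G.degree v : ℝ) ≠ 0 := by exact_mod_cast (hdeg v hv).ne'
    have h1 := congrFun hg v
    rw [SimpleGraph.lapMatrix_mulVec_apply] at h1
    have h2 : ∑ w, srwStep G v w * g w = (∑ w ∈ G.neighborFinset v, g w) / G.degree v := by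
      rw [SimpleGraph.neighborFinset_eq_filter, Finset.sum_filter, Finset.sum_div]
      refine Finset.sum_congr rfl fun w _ => ?_
      simp only [srwStep]; split_ifs <;> ring
    simp only [hd, if_pos hv] at h1
    rw [h2]
    field_simp
    linarith
  · push Not at hdeg
    obtain ⟨v, hv, hv0⟩ := hdeg
    -- `C` is an isolated vertex, where `srwStep` vanishes identically.
    refine ⟨h, 0, fun u hu => ?_, fun _ => le_rfl⟩
    have huv : u = v := by
      by_contra hne
      have : G.Reachable v u := SimpleGraph.ConnectedComponent.exact (hv.trans hu.symm)
      exact absurd (this.degree_pos_left (Ne.symm hne)) (by omega)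
    have hadj : ∀ w, ¬ G.Adj u w := fun w hw => by
      have := (G.degree_pos_iff_exists_adj u).2 ⟨w, hw⟩
      rw [huv] at this; omega
    simp [srwStep, hadj]

theorem sum_srwStep_mul_sub {V : Type*} [Fintype V] (G : SimpleGraph V)
    [DecidableRel G.Adj] (g : V → ℝ) (v : V) :
    ∑ w, srwStep G v w * (g w - ∑ w', srwStep G v w' * g w') = 0 := by
  simp_rw [mul_sub]
  rw [Finset.sum_sub_distrib, ← Finset.sum_mul]
  have h1 : ∑ w, srwStep G v w = (G.degree v : ℝ) * (1 / G.degree v) := by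
    classical
    simp only [srwStep]
    rw [← Finset.sum_filter, ← SimpleGraph.neighborFinset_eq_filter, Finset.sum_const,
      SimpleGraph.card_neighborFinset_eq_degree, nsmul_eq_mul]
  by_cases hv : (G.degree v : ℝ) = 0
  · simp [srwStep, hv]
  · rw [h1, mul_one_div_cancel hv, one_mul, sub_self]

/-- The uniform weight cancels from the mean-zero identity; this unweighted form is what a completed
circulation of `N(v)` uses. -/
theorem sum_neighborFinset_sub {V : Type*} [Fintype V] (G : SimpleGraph V)
    [DecidableRel G.Adj] (g : V → ℝ) (v : V) :
    ∑ w ∈ G.neighborFinset v, (g w - ∑ w', srwStep G v w' * g w') = 0 := by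
  classical
  by_cases hv : (G.degree v : ℝ) = 0
  · have : G.neighborFinset v = ∅ := by
      rw [← Finset.card_eq_zero, SimpleGraph.card_neighborFinset_eq_degree]; exact_mod_cast hv
    rw [this, Finset.sum_empty]
  · have h := sum_srwStep_mul_sub G g v
    have h2 : ∀ w, srwStep G v w * (g w - ∑ w', srwStep G v w' * g w') =
        1 / (G.degree v : ℝ) * if G.Adj v w then (g w - ∑ w', srwStep G v w' * g w') else 0 := by
      intro w; rw [srwStep]; split_ifs <;> simp
    rw [Finset.sum_congr rfl fun w _ => h2 w, ← Finset.mul_sum] at h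
    rw [SimpleGraph.neighborFinset_eq_filter, Finset.sum_filter]
    exact (mul_eq_zero.1 h).resolve_left (one_div_ne_zero hv)

/-! ### Almost sure path properties and the path decomposition -/

/-- Almost surely, every finite initial piece of the realized path has positive probability. -/
theorem ae_measureReal_cylinder_ne_zero {V Ω : Type*} [Finite V] [MeasurableSpace Ω]
    (P : Measure Ω) [IsFiniteMeasure P] (X : ℕ → Ω → V) :
    ∀ᵐ ω ∂P, ∀ n, P.real {ω' | ∀ i ≤ n, X i ω' = X i ω} ≠ 0 := by
  rw [ae_all_iff]
  intro n
  let Y : Ω → (Fin (n + 1) → V) := fun ω i => X i ω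
  have hset : ∀ ω, {ω' | ∀ i ≤ n, X i ω' = X i ω} = Y ⁻¹' {Y ω} := by
    intro ω; ext ω'
    simp only [Set.mem_ofPred_eq, Set.mem_preimage, Set.mem_singleton_iff, Y, funext_iff,
      Fin.forall_iff, Nat.lt_succ_iff]
  -- The bad paths lie in a countable union of null fibres of the prefix map.
  have hsub : {ω | ¬ P.real {ω' | ∀ i ≤ n, X i ω' = X i ω} ≠ 0} ⊆
      ⋃ y ∈ {y | P (Y ⁻¹' {y}) = 0}, Y ⁻¹' {y} := by
    intro ω hω
    rw [Set.mem_ofPred_eq, not_not, hset, measureReal_eq_zero_iff] at hω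
    exact Set.mem_biUnion (x := Y ω) hω rfl
  exact measure_mono_null hsub ((measure_biUnion_null_iff (Set.to_countable _)).2 fun y hy => hy)

theorem mem_supp_of_forall_adj {V : Type*} {G : SimpleGraph V}
    {C : G.ConnectedComponent} {x : ℕ → V} (h0 : x 0 ∈ C.supp)
    (hx : ∀ n, G.Adj (x n) (x (n + 1))) (n : ℕ) : x n ∈ C.supp := by
  induction n with
  | zero => exact h0
  | succ n ih => exact (SimpleGraph.ConnectedComponent.mem_supp_congr_adj C (hx n)).1 ih

theorem exists_abs_le_of_finite {ι : Type*} [Finite ι] (g : ι → ℝ) :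
    ∃ K, 0 ≤ K ∧ ∀ i, |g i| ≤ K := by
  obtain ⟨K, hK⟩ := (Set.finite_range fun i => |g i|).bddAbove
  exact ⟨max K 0, le_max_right _ _, fun i => (hK ⟨i, rfl⟩).trans (le_max_left _ _)⟩

/-- Purely deterministic, so it serves both walks. -/
theorem sum_Icc_sub_eq_of_poisson {V : Type*} [Fintype V] {G : SimpleGraph V}
    [DecidableRel G.Adj] {C : G.ConnectedComponent} {f g : V → ℝ} {c : ℝ}
    (hg : ∀ v ∈ C.supp, f v - c = g v - ∑ w, srwStep G v w * g w) {x : ℕ → V}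
    (hx : ∀ n, x n ∈ C.supp) (n : ℕ) :
    ∑ t ∈ Finset.Icc 1 n, f (x t) - n * c = g (x 1) - g (x (n + 1)) +
      ∑ t ∈ Finset.range n, (g (x (t + 2)) - ∑ w, srwStep G (x (t + 1)) w * g w) := by
  induction n with
  | zero => simp
  | succ n ih =>
    rw [Finset.sum_Icc_succ_top (by omega), Finset.sum_range_succ]
    have := hg _ (hx (n + 1))
    push_cast
    linarith

/-- A forbidden step would give the realized prefix probability zero. -/
theorem IsSRW.ae_adj {V : Type*} [Fintype V] [MeasurableSpace V] {G : SimpleGraph V}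
    [DecidableRel G.Adj] {Ω : Type*} [MeasurableSpace Ω] {P : Measure Ω} [IsFiniteMeasure P]
    {X : ℕ → Ω → V} (hX : IsSRW G P X) : ∀ᵐ ω ∂P, ∀ n, G.Adj (X n ω) (X (n + 1) ω) := by
  filter_upwards [ae_measureReal_cylinder_ne_zero P X] with ω hω n
  by_contra h
  refine hω (n + 1) ?_
  rw [hX.step n fun i => X i ω, srwStep, if_neg h, mul_zero]

theorem IsCNRW.ae_mem_candidates {V : Type*} [Fintype V] [DecidableEq V] [MeasurableSpace V]
    {G : SimpleGraph V} [DecidableRel G.Adj] {Ω : Type*} [MeasurableSpace Ω] {P : Measure Ω}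
    [IsFiniteMeasure P] {X : ℕ → Ω → V} (hX : IsCNRW G P X) :
    ∀ᵐ ω ∂P, ∀ n, X (n + 2) ω ∈ cnrwCandidates G (fun i => X i ω) n := by
  filter_upwards [ae_measureReal_cylinder_ne_zero P X] with ω hω n
  by_contra h
  refine hω (n + 2) ?_
  rw [hX.step n fun i => X i ω, cnrwStep, if_neg h, mul_zero]

/-! ### The circulated walk: cancellation and zero asymptotic variance -/

/-- Along a walk that respects the memory, the increments `φ (x (t + 1)) (x (t + 2))` telescope to
the sum of `φ` over the memory, if `φ v` sums to zero over the neighbours of `v`. -/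
theorem sum_range_eq_sum_cnrwMemory {V : Type*} [Fintype V] [DecidableEq V] (G : SimpleGraph V)
    [DecidableRel G.Adj] (φ : V → V → ℝ) (hφ : ∀ v, ∑ w ∈ G.neighborFinset v, φ v w = 0)
    {x : ℕ → V} (hx : ∀ n, x (n + 2) ∈ cnrwCandidates G x n) (n : ℕ) :
    ∑ t ∈ Finset.range n, φ (x (t + 1)) (x (t + 2)) =
      ∑ u, ∑ v, ∑ w ∈ cnrwMemory G x (n + 1) u v, φ v w := by
  induction n with
  | zero => simp [cnrwMemory]
  | succ n ih =>
    have hnot : x (n + 2) ∉ cnrwMemory G x (n + 1) (x n) (x (n + 1)) :=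
      (Finset.mem_sdiff.1 (hx n)).2
    have key : ∀ u v, ∑ w ∈ cnrwMemory G x (n + 2) u v, φ v w =
        ∑ w ∈ cnrwMemory G x (n + 1) u v, φ v w +
          if u = x n then if v = x (n + 1) then φ v (x (n + 2)) else 0 else 0 := by
      intro u v
      rw [cnrwMemory]
      beta_reduce
      by_cases h : u = x n ∧ v = x (n + 1)
      · obtain ⟨rfl, rfl⟩ := h
        have hins := Finset.sum_insert (f := φ (x (n + 1))) hnot
        simp only [and_self, if_true]
        split_ifs with hfull
        -- Reset: the completed set is `N(v)`, with sum zero, so emptying it changes nothing.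
        · rw [hfull, hφ] at hins
          rw [Finset.sum_empty]; linarith
        · rw [hins, add_comm]
      · rw [if_neg h, ← ite_and, if_neg h, add_zero]
    rw [Finset.sum_range_succ, ih]
    simp only [key, Finset.sum_add_distrib]
    simp

theorem mul_variance_empiricalMean {V Ω : Type*} [MeasurableSpace Ω] (P : Measure Ω)
    (f : V → ℝ) (X : ℕ → Ω → V) (n : ℕ) :
    (n : ℝ) * variance (empiricalMean f X n) P =
      variance (fun ω => ∑ t ∈ Finset.Icc 1 n, f (X t ω)) P / n := by
  have : empiricalMean f X n = fun ω => (1 / (n : ℝ)) * ∑ t ∈ Finset.Icc 1 n, f (X t ω) := rfl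
  rw [this, variance_const_mul]
  rcases eq_or_ne (n : ℝ) 0 with h | h
  · simp [h]
  · field_simp

theorem tendsto_div_natCast_of_abs_le {a : ℕ → ℝ} {K : ℝ} (ha : ∀ n, |a n| ≤ K) :
    Tendsto (fun n : ℕ => a n / n) atTop (𝓝 0) := by
  refine squeeze_zero_norm (a := fun n : ℕ => K / n) (fun n => ?_)
    (tendsto_const_div_atTop_nhds_zero_nat K)
  rw [norm_div, Real.norm_eq_abs, Real.norm_natCast]
  gcongr
  exact ha n

/-- The asymptotic variance of the circulated neighbors random walk vanishes: the centred sums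
`∑ (f (X t) - c)` are bounded along every path. -/
theorem IsCNRW.hasAsymptoticVariance_zero {V : Type*} [Fintype V] [DecidableEq V]
    [MeasurableSpace V] [MeasurableSingletonClass V] {G : SimpleGraph V} [DecidableRel G.Adj]
    {C : G.ConnectedComponent} (f : V → ℝ) {Ω : Type*} [MeasurableSpace Ω] {P : Measure Ω}
    [IsProbabilityMeasure P] {X : ℕ → Ω → V} (hX : IsCNRW G P X)
    (hC : ∀ᵐ ω ∂P, X 0 ω ∈ C.supp) : HasAsymptoticVariance P X f 0 := by
  obtain ⟨g, c, hg, -⟩ := exists_poisson G C f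
  obtain ⟨K₁, hK₁, hgK⟩ := exists_abs_le_of_finite g
  let φ : V → V → ℝ := fun v w => g w - ∑ w', srwStep G v w' * g w'
  -- There are finitely many memory states, hence one bound for all times and paths.
  obtain ⟨K₂, hK₂, hφK⟩ := exists_abs_le_of_finite
    fun b : V → V → Finset V => ∑ u, ∑ v, ∑ w ∈ b u v, φ v w
  have hmeas : ∀ n, Measurable fun ω => ∑ t ∈ Finset.Icc 1 n, f (X t ω) := fun n =>
    Finset.measurable_fun_sum _ fun t _ => (measurable_of_finite f).comp (hX.measurable t)
  have hbound : ∀ᵐ ω ∂P, ∀ n : ℕ,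
      |∑ t ∈ Finset.Icc 1 n, f (X t ω) - n * c| ≤ K₁ + K₁ + K₂ := by
    filter_upwards [hX.ae_mem_candidates, hX.adj, hC] with ω hω h01 h0 n
    have hadj : ∀ n, G.Adj (X n ω) (X (n + 1) ω) := by
      rintro (_ | n)
      · exact h01
      · exact (G.mem_neighborFinset _ _).1 (Finset.mem_sdiff.1 (hω n)).1
    rw [sum_Icc_sub_eq_of_poisson hg (x := fun t => X t ω) (mem_supp_of_forall_adj h0 hadj) n]
    have := sum_range_eq_sum_cnrwMemory G φ (sum_neighborFinset_sub G g) hω n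
    simp only [φ] at this
    rw [this]
    exact (abs_add_le _ _).trans (add_le_add ((abs_sub _ _).trans (add_le_add (hgK _) (hgK _)))
      (hφK _))
  simp only [HasAsymptoticVariance, mul_variance_empiricalMean]
  refine tendsto_div_natCast_of_abs_le (K := (K₁ + K₁ + K₂) ^ 2) fun n => ?_
  rw [abs_of_nonneg (variance_nonneg _ _),
    ← variance_sub_const (hmeas n).aestronglyMeasurable (n * c)]
  refine (variance_le_expectation_sq
    ((hmeas n).sub_const _).aestronglyMeasurable).trans ?_
  have : ∀ᵐ ω ∂P, (∑ t ∈ Finset.Icc 1 n, f (X t ω) - n * c) ^ 2 ≤ (K₁ + K₁ + K₂) ^ 2 := by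
    filter_upwards [hbound] with ω hω
    exact sq_le_sq' (abs_le.1 (hω n)).1 (abs_le.1 (hω n)).2
  simpa using integral_mono_of_nonneg (Eventually.of_forall fun ω => sq_nonneg _)
    (integrable_const _) this

/-! ### The simple random walk: Markov property and martingale -/

theorem integral_comp_eq_sum {Ω E : Type*} [MeasurableSpace Ω] {P : Measure Ω}
    [IsFiniteMeasure P] [Fintype E] [MeasurableSpace E] [MeasurableSingletonClass E]
    {Z : Ω → E} (hZ : Measurable Z) (φ : E → ℝ) :
    ∫ ω, φ (Z ω) ∂P = ∑ e, P.real (Z ⁻¹' {e}) * φ e := by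
  rw [← integral_map (φ := Z) (f := φ) hZ.aemeasurable
    (measurable_of_finite φ).aestronglyMeasurable, integral_fintype .of_finite]
  simp [map_measureReal_apply hZ]

/-- The Markov property of the simple random walk, for a functional of the path up to time `n` and
the next vertex. -/
theorem IsSRW.integral_eq {V : Type*} [Fintype V] [MeasurableSpace V]
    [MeasurableSingletonClass V] {G : SimpleGraph V} [DecidableRel G.Adj] {Ω : Type*}
    [MeasurableSpace Ω] {P : Measure Ω} [IsFiniteMeasure P] {X : ℕ → Ω → V} (hX : IsSRW G P X)
    (n : ℕ) (F : (ℕ → V) → V → ℝ) (hF : ∀ x y : ℕ → V, (∀ i ≤ n, x i = y i) → F x = F y) :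
    ∫ ω, F (fun i => X i ω) (X (n + 1) ω) ∂P =
      ∫ ω, ∑ w, srwStep G (X n ω) w * F (fun i => X i ω) w ∂P := by
  classical
  let Y : Ω → (Fin (n + 1) → V) := fun ω i => X i ω
  have hY : Measurable Y := measurable_pi_lambda _ fun i => hX.measurable i
  -- Pads a prefix by repeating its last vertex; `F` does not see the padding.
  let ext : (Fin (n + 1) → V) → ℕ → V := fun y i => y ⟨min i n, by omega⟩
  have hext : ∀ ω, F (fun i => X i ω) = F (ext (Y ω)) := fun ω =>
    hF _ _ fun i hi => by simp [ext, Y, min_eq_left hi]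
  have h1 := integral_comp_eq_sum (P := P) (hY.prodMk (hX.measurable (n + 1)))
    fun p => F (ext p.1) p.2
  have h2 := integral_comp_eq_sum (P := P) hY
    fun y => ∑ w, srwStep G (y (Fin.last n)) w * F (ext y) w
  simp only [hext]
  refine h1.trans (Eq.trans ?_ h2.symm)
  rw [Fintype.sum_prod_type]
  refine Finset.sum_congr rfl fun y _ => ?_
  rw [Finset.mul_sum]
  refine Finset.sum_congr rfl fun w _ => ?_
  rw [← mul_assoc]
  congr 1
  have h3 := hX.step n fun i => if i ≤ n then ext y i else w
  have h4 : {ω | ∀ i ≤ n, X i ω = if i ≤ n then ext y i else w} = Y ⁻¹' {y} := by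
    ext ω
    simp only [Set.mem_ofPred_eq, Set.mem_preimage, Set.mem_singleton_iff, Y, funext_iff,
      Fin.forall_iff, Nat.lt_succ_iff, ext]
    refine forall₂_congr fun i hi => ?_
    simp [hi]
  have h5 : {ω | ∀ i ≤ n + 1, X i ω = if i ≤ n then ext y i else w} =
      (fun ω => (Y ω, X (n + 1) ω)) ⁻¹' {(y, w)} := by
    have : {ω | ∀ i ≤ n + 1, X i ω = if i ≤ n then ext y i else w} =
        {ω | ∀ i ≤ n, X i ω = if i ≤ n then ext y i else w} ∩ {ω | X (n + 1) ω = w} := by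
      ext ω
      simp [Nat.le_succ_iff, or_imp, forall_and]
    rw [this, h4]
    ext ω
    simp
  rw [h4, h5] at h3
  simpa [ext, Fin.last] using h3

/-- The functional factors through the finite set of prefixes. -/
theorem measurable_and_bounded_of_dependsOn_prefix {V : Type*} [Finite V] [MeasurableSpace V]
    [MeasurableSingletonClass V] {Ω : Type*} [MeasurableSpace Ω] {X : ℕ → Ω → V}
    (hX : ∀ t, Measurable (X t)) {Φ : (ℕ → V) → ℝ} (n : ℕ)
    (hΦ : ∀ x y : ℕ → V, (∀ i ≤ n, x i = y i) → Φ x = Φ y) :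
    Measurable (fun ω => Φ fun i => X i ω) ∧ ∃ K, ∀ ω, |Φ fun i => X i ω| ≤ K := by
  let Y : Ω → (Fin (n + 1) → V) := fun ω i => X i ω
  have hY : Measurable Y := measurable_pi_lambda _ fun i => hX i
  let Ψ : (Fin (n + 1) → V) → ℝ := fun y => Φ fun i => y ⟨min i n, by omega⟩
  have hext : (fun ω => Φ fun i => X i ω) = Ψ ∘ Y := funext fun ω =>
    hΦ _ _ fun i hi => by simp [Y, min_eq_left hi]
  obtain ⟨K, -, hK⟩ := exists_abs_le_of_finite Ψ
  exact ⟨hext ▸ (measurable_of_finite Ψ).comp hY, K, fun ω => congrFun hext ω ▸ hK _⟩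

theorem memLp_of_dependsOn_prefix {V : Type*} [Finite V] [MeasurableSpace V]
    [MeasurableSingletonClass V] {Ω : Type*} [MeasurableSpace Ω] {P : Measure Ω}
    [IsFiniteMeasure P] {X : ℕ → Ω → V} (hX : ∀ t, Measurable (X t)) {Φ : (ℕ → V) → ℝ} (n : ℕ)
    (hΦ : ∀ x y : ℕ → V, (∀ i ≤ n, x i = y i) → Φ x = Φ y) :
    MemLp (fun ω => Φ fun i => X i ω) 2 P := by
  obtain ⟨hm, K, hK⟩ := measurable_and_bounded_of_dependsOn_prefix hX n hΦ
  exact MemLp.of_bound hm.aestronglyMeasurable K (Eventually.of_forall hK)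

/-- The martingale `∑_{t < n} (g (x (t + 2)) - (P g) (x (t + 1)))` of the simple random walk. -/
noncomputable def srwMartingale {V : Type*} [Fintype V] (G : SimpleGraph V) [DecidableRel G.Adj]
    (g : V → ℝ) (n : ℕ) (x : ℕ → V) : ℝ :=
  ∑ t ∈ Finset.range n, (g (x (t + 2)) - ∑ w, srwStep G (x (t + 1)) w * g w)

theorem srwMartingale_congr {V : Type*} [Fintype V] (G : SimpleGraph V) [DecidableRel G.Adj]
    (g : V → ℝ) (n : ℕ) (x y : ℕ → V) (h : ∀ i ≤ n + 1, x i = y i) :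
    srwMartingale G g n x = srwMartingale G g n y :=
  Finset.sum_congr rfl fun t ht => by
    have := Finset.mem_range.1 ht
    rw [h (t + 2) (by omega), h (t + 1) (by omega)]

theorem srwMartingale_succ {V : Type*} [Fintype V] (G : SimpleGraph V) [DecidableRel G.Adj]
    (g : V → ℝ) (n : ℕ) (x : ℕ → V) :
    srwMartingale G g (n + 1) x =
      srwMartingale G g n x + (g (x (n + 2)) - ∑ w, srwStep G (x (n + 1)) w * g w) :=
  Finset.sum_range_succ _ _

/-- The variance of one step of `g` along the simple random walk, as a function of the current
vertex. -/
noncomputable def srwStepVariance {V : Type*} [Fintype V] (G : SimpleGraph V)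
    [DecidableRel G.Adj] (g : V → ℝ) (v : V) : ℝ :=
  ∑ w, srwStep G v w * (g w - ∑ w', srwStep G v w' * g w') ^ 2

theorem srwStepVariance_nonneg {V : Type*} [Fintype V] (G : SimpleGraph V)
    [DecidableRel G.Adj] (g : V → ℝ) (v : V) :
    0 ≤ srwStepVariance G g v :=
  Finset.sum_nonneg fun w _ => mul_nonneg (by rw [srwStep]; split_ifs <;> positivity)
    (sq_nonneg _)

section

variable {V : Type*} [Fintype V] [MeasurableSpace V] [MeasurableSingletonClass V]
  {G : SimpleGraph V} [DecidableRel G.Adj] {Ω : Type*} [MeasurableSpace Ω] {P : Measure Ω}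
  {X : ℕ → Ω → V}

theorem IsSRW.memLp_srwMartingale [IsFiniteMeasure P] (hX : IsSRW G P X) (g : V → ℝ) (n : ℕ) :
    MemLp (fun ω => srwMartingale G g n fun i => X i ω) 2 P :=
  memLp_of_dependsOn_prefix hX.measurable (n + 1) (srwMartingale_congr G g n)

theorem IsSRW.integral_srwMartingale [IsFiniteMeasure P] (hX : IsSRW G P X) (g : V → ℝ) (n : ℕ) :
    ∫ ω, srwMartingale G g n (fun i => X i ω) ∂P = 0 := by
  induction n with
  | zero => simp [srwMartingale]
  | succ n ih =>
    simp only [srwMartingale_succ]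
    rw [integral_add ((hX.memLp_srwMartingale g n).integrable (by norm_num)), ih, zero_add]
    · rw [hX.integral_eq (n + 1) (fun x w => g w - ∑ w', srwStep G (x (n + 1)) w' * g w')
        fun x y h => by simp only [h _ le_rfl]]
      simp [sum_srwStep_mul_sub]
    · exact (memLp_of_dependsOn_prefix hX.measurable
        (Φ := fun x => g (x (n + 2)) - ∑ w, srwStep G (x (n + 1)) w * g w) (n + 2)
        fun x y h => by simp only [h (n + 2) le_rfl, h (n + 1) (by omega)]).integrable (by norm_num)

/-- Given the past, each increment is centred, so the cross terms vanish and only the conditional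
variances survive. -/
theorem IsSRW.integral_srwMartingale_sq [IsFiniteMeasure P] (hX : IsSRW G P X) (g : V → ℝ)
    (n : ℕ) :
    ∫ ω, srwMartingale G g n (fun i => X i ω) ^ 2 ∂P =
      ∫ ω, ∑ t ∈ Finset.Icc 1 n, srwStepVariance G g (X t ω) ∂P := by
  induction n with
  | zero => simp [srwMartingale]
  | succ n ih =>
    let D : (ℕ → V) → V → ℝ := fun x w => g w - ∑ w', srwStep G (x (n + 1)) w' * g w'
    let F : (ℕ → V) → V → ℝ := fun x w => 2 * srwMartingale G g n x * D x w + D x w ^ 2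
    have hF : ∀ x y : ℕ → V, (∀ i ≤ n + 1, x i = y i) → F x = F y := fun x y h => by
      simp only [F, D, h _ le_rfl, srwMartingale_congr G g n x y h]
    have h1 : ∀ ω, srwMartingale G g (n + 1) (fun i => X i ω) ^ 2 =
        srwMartingale G g n (fun i => X i ω) ^ 2 + F (fun i => X i ω) (X (n + 2) ω) := fun ω => by
      rw [srwMartingale_succ]; simp only [F, D]; ring
    have h2 : ∀ ω, ∑ w, srwStep G (X (n + 1) ω) w * F (fun i => X i ω) w =
        srwStepVariance G g (X (n + 1) ω) := fun ω => by
      have h3 := sum_srwStep_mul_sub G g (X (n + 1) ω)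
      have h4 : ∀ w, srwStep G (X (n + 1) ω) w * F (fun i => X i ω) w =
          2 * srwMartingale G g n (fun i => X i ω) * (srwStep G (X (n + 1) ω) w *
            (g w - ∑ w', srwStep G (X (n + 1) ω) w' * g w')) + srwStep G (X (n + 1) ω) w *
            (g w - ∑ w', srwStep G (X (n + 1) ω) w' * g w') ^ 2 := fun w => by
        simp only [F, D]; ring
      rw [Finset.sum_congr rfl fun w _ => h4 w, Finset.sum_add_distrib, ← Finset.mul_sum, h3,
        mul_zero, zero_add, srwStepVariance]
    have h5 : Integrable (fun ω => F (fun i => X i ω) (X (n + 2) ω)) P :=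
      (memLp_of_dependsOn_prefix hX.measurable (Φ := fun x => F x (x (n + 2))) (n + 2)
        fun x y h => by
          simp only [hF x y fun i hi => h i (by omega), h (n + 2) le_rfl]).integrable (by norm_num)
    have h6 : ∀ m, Integrable (fun ω => srwStepVariance G g (X m ω)) P := fun m =>
      (memLp_of_dependsOn_prefix hX.measurable (Φ := fun x => srwStepVariance G g (x m)) m
        fun x y h => by simp only [h m le_rfl]).integrable (by norm_num)
    simp only [h1, Finset.sum_Icc_succ_top (Nat.le_add_left 1 n)]
    rw [integral_add (hX.memLp_srwMartingale g n).integrable_sq h5, ih,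
      integral_add (integrable_finsetSum _ fun t _ => h6 t) (h6 _),
      hX.integral_eq (n + 1) F hF]
    simp only [h2]

/-- The ergodic theorem in mean for the simple random walk, with rate `1 / n`. -/
theorem IsSRW.abs_integral_sum_sub_le [IsProbabilityMeasure P] (hX : IsSRW G P X)
    {C : G.ConnectedComponent} (hC : ∀ᵐ ω ∂P, X 0 ω ∈ C.supp) {h k : V → ℝ} {c K : ℝ}
    (hk : ∀ v ∈ C.supp, h v - c = k v - ∑ w, srwStep G v w * k w) (hK : ∀ v, |k v| ≤ K) (n : ℕ) :
    |∫ ω, ∑ t ∈ Finset.Icc 1 n, h (X t ω) ∂P - n * c| ≤ K + K := by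
  have hae : (fun ω => ∑ t ∈ Finset.Icc 1 n, h (X t ω)) =ᵐ[P] fun ω =>
      (n * c + (k (X 1 ω) - k (X (n + 1) ω))) + srwMartingale G k n fun i => X i ω := by
    filter_upwards [hX.ae_adj, hC] with ω hω h0
    have := sum_Icc_sub_eq_of_poisson hk (x := fun t => X t ω) (mem_supp_of_forall_adj h0 hω) n
    rw [srwMartingale]
    linarith
  have hint : Integrable (fun ω => k (X 1 ω) - k (X (n + 1) ω)) P :=
    (memLp_of_dependsOn_prefix hX.measurable (Φ := fun x => k (x 1) - k (x (n + 1))) (n + 1)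
      fun x y h => by simp only [h 1 (by omega), h (n + 1) le_rfl]).integrable (by norm_num)
  have hint' : Integrable (fun ω => n * c + (k (X 1 ω) - k (X (n + 1) ω))) P :=
    (integrable_const _).add hint
  rw [integral_congr_ae hae, integral_add hint'
    ((hX.memLp_srwMartingale k n).integrable (by norm_num)), hX.integral_srwMartingale,
    integral_add (integrable_const _) hint]
  simp only [integral_const, probReal_univ, one_smul, add_zero, add_sub_cancel_left]
  simpa using norm_integral_le_of_norm_le_const (μ := P) (C := K + K)
    (f := fun ω => k (X 1 ω) - k (X (n + 1) ω))
    (Eventually.of_forall fun ω => (abs_sub _ _).trans (add_le_add (hK _) (hK _)))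

end

/-! ### The simple random walk: limit of the normalized variance -/

/-- The quadratic `s ↦ Var(s Y + Z)` is nonnegative, so its discriminant is at most 0. -/
theorem sq_covariance_le {Ω : Type*} [MeasurableSpace Ω] {P : Measure Ω} [IsFiniteMeasure P]
    {Y Z : Ω → ℝ} (hY : MemLp Y 2 P) (hZ : MemLp Z 2 P) :
    covariance Y Z P ^ 2 ≤ variance Y P * variance Z P := by
  have h : ∀ s : ℝ, 0 ≤ variance Y P * (s * s) + 2 * covariance Y Z P * s + variance Z P := by
    intro s
    have h1 := variance_fun_add (hY.const_mul s) hZ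
    rw [variance_const_mul, covariance_const_mul_left] at h1
    have h2 := variance_nonneg (fun ω => s * Y ω + Z ω) P
    rw [h1] at h2
    linarith
  have := discrim_le_zero h
  rw [discrim] at this
  linarith

/-- Shows that a bounded perturbation is negligible after division by `n` when `Var Z` grows
linearly. -/
theorem abs_variance_add_sub_le {Ω : Type*} [MeasurableSpace Ω] {P : Measure Ω}
    [IsProbabilityMeasure P] {Y Z : Ω → ℝ} (hY : MemLp Y 2 P) (hZ : MemLp Z 2 P) {K : ℝ}
    (hK : ∀ ω, |Y ω| ≤ K) :
    |variance (fun ω => Y ω + Z ω) P - variance Z P| ≤ K ^ 2 + 2 * (|K| * √(variance Z P)) := by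
  have hvar : variance Y P ≤ K ^ 2 := by
    refine (variance_le_expectation_sq hY.aestronglyMeasurable).trans ?_
    simpa using integral_mono_of_nonneg (μ := P) (f := fun ω => Y ω ^ 2) (g := fun _ => K ^ 2)
      (Eventually.of_forall fun ω => sq_nonneg _) (integrable_const _)
      (Eventually.of_forall fun ω => sq_le_sq' (abs_le.1 (hK ω)).1 (abs_le.1 (hK ω)).2)
  have hcov : |covariance Y Z P| ≤ |K| * √(variance Z P) := by
    rw [← Real.sqrt_sq_eq_abs K, ← Real.sqrt_mul (sq_nonneg K)]
    exact Real.abs_le_sqrt ((sq_covariance_le hY hZ).trans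
      (mul_le_mul_of_nonneg_right hvar (variance_nonneg _ _)))
  have hY0 := variance_nonneg Y P
  rw [variance_fun_add hY hZ, abs_le]
  constructor <;> linarith [abs_le.1 hcov]

/-- The asymptotic variance of the simple random walk is the stationary mean `c` of the one-step
variance of a solution `g` of the Poisson equation. -/
theorem IsSRW.hasAsymptoticVariance {V : Type*} [Fintype V] [MeasurableSpace V]
    [MeasurableSingletonClass V] {G : SimpleGraph V} [DecidableRel G.Adj] {Ω : Type*}
    [MeasurableSpace Ω] {P : Measure Ω} [IsProbabilityMeasure P] {X : ℕ → Ω → V}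
    (hX : IsSRW G P X) {C : G.ConnectedComponent} (hC : ∀ᵐ ω ∂P, X 0 ω ∈ C.supp)
    {f g k : V → ℝ} {m c : ℝ}
    (hg : ∀ v ∈ C.supp, f v - m = g v - ∑ w, srwStep G v w * g w)
    (hk : ∀ v ∈ C.supp, srwStepVariance G g v - c = k v - ∑ w, srwStep G v w * k w) :
    HasAsymptoticVariance P X f c := by
  obtain ⟨K, -, hK⟩ := exists_abs_le_of_finite g
  obtain ⟨L, -, hL⟩ := exists_abs_le_of_finite k
  let M : ℕ → Ω → ℝ := fun n ω => srwMartingale G g n fun i => X i ω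
  let B : ℕ → Ω → ℝ := fun n ω => g (X 1 ω) - g (X (n + 1) ω)
  have hM : ∀ n, MemLp (M n) 2 P := hX.memLp_srwMartingale g
  have hB : ∀ n, MemLp (B n) 2 P := fun n =>
    memLp_of_dependsOn_prefix hX.measurable (Φ := fun x => g (x 1) - g (x (n + 1))) (n + 1)
      fun x y h => by simp only [h 1 (by omega), h (n + 1) le_rfl]
  have hBK : ∀ n ω, |B n ω| ≤ K + K := fun n ω =>
    (abs_sub _ _).trans (add_le_add (hK _) (hK _))
  have hmeas : ∀ n, Measurable fun ω => ∑ t ∈ Finset.Icc 1 n, f (X t ω) := fun n =>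
    Finset.measurable_fun_sum _ fun t _ => (measurable_of_finite f).comp (hX.measurable t)
  have hS : ∀ n : ℕ, variance (fun ω => ∑ t ∈ Finset.Icc 1 n, f (X t ω)) P =
      variance (fun ω => B n ω + M n ω) P := fun n => by
    rw [← variance_sub_const (hmeas n).aestronglyMeasurable (n * m)]
    refine variance_congr ?_
    filter_upwards [hX.ae_adj, hC] with ω hω h0
    exact sum_Icc_sub_eq_of_poisson hg (x := fun t => X t ω) (mem_supp_of_forall_adj h0 hω) n
  have hMvar : ∀ n : ℕ, |variance (M n) P - n * c| ≤ L + L := fun n => by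
    rw [variance_of_integral_eq_zero (hM n).aestronglyMeasurable.aemeasurable
      (hX.integral_srwMartingale g n), hX.integral_srwMartingale_sq g n]
    exact hX.abs_integral_sum_sub_le hC hk hL n
  have hlimM : Tendsto (fun n : ℕ => variance (M n) P / n) atTop (𝓝 c) := by
    have h := (tendsto_div_natCast_of_abs_le hMvar).add_const c
    rw [zero_add] at h
    refine h.congr' ?_
    filter_upwards [eventually_ne_atTop 0] with n hn
    field_simp
    ring
  have hlim0 : Tendsto (fun n : ℕ => (variance (fun ω => B n ω + M n ω) P - variance (M n) P) / n)
      atTop (𝓝 0) := by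
    have h0 : Tendsto (fun n : ℕ => (1 : ℝ) / n) atTop (𝓝 0) :=
      tendsto_const_div_atTop_nhds_zero_nat 1
    -- Writing `√Var / n` as `√(Var / n * (1 / n))` brings in the known limit of `Var / n`.
    have h1 : Tendsto (fun n : ℕ => (K + K) ^ 2 / n +
        2 * (|K + K| * √(variance (M n) P / n * (1 / n)))) atTop (𝓝 0) := by
      have h2 := (tendsto_const_div_atTop_nhds_zero_nat ((K + K) ^ 2)).add
        ((((hlimM.mul h0).sqrt).const_mul |K + K|).const_mul 2)
      simpa using h2
    refine squeeze_zero_norm (fun n => ?_) h1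
    rw [norm_div, Real.norm_eq_abs, Real.norm_natCast]
    have h3 : √(variance (M n) P / n * (1 / n)) = √(variance (M n) P) / n := by
      rw [div_mul_div_comm, mul_one, ← sq, Real.sqrt_div (variance_nonneg _ _),
        Real.sqrt_sq (Nat.cast_nonneg n)]
    rw [h3]
    refine (div_le_div_of_nonneg_right (abs_variance_add_sub_le (hB n) (hM n) (hBK n))
      (Nat.cast_nonneg n)).trans (le_of_eq ?_)
    ring
  simp only [HasAsymptoticVariance, mul_variance_empiricalMean, hS]
  have h := hlim0.add hlimM
  rw [zero_add] at h
  exact h.congr fun n => by ring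

theorem theorem2 {V : Type*} [Fintype V] [DecidableEq V] [MeasurableSpace V]
    [MeasurableSingletonClass V] (G : SimpleGraph V) [DecidableRel G.Adj]
    (C : G.ConnectedComponent) (f : V → ℝ) :
    ∃ sSRW sCNRW : ℝ,
      (∀ (Ω : Type*) [MeasurableSpace Ω] (P : Measure Ω) [IsProbabilityMeasure P]
        (X : ℕ → Ω → V), IsSRW G P X → (∀ᵐ ω ∂P, X 0 ω ∈ C.supp) →
          HasAsymptoticVariance P X f sSRW) ∧
      (∀ (Ω' : Type*) [MeasurableSpace Ω'] (P' : Measure Ω') [IsProbabilityMeasure P']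
        (X' : ℕ → Ω' → V), IsCNRW G P' X' → (∀ᵐ ω ∂P', X' 0 ω ∈ C.supp) →
          HasAsymptoticVariance P' X' f sCNRW) ∧
      sCNRW ≤ sSRW := by
  obtain ⟨g, m, hg, -⟩ := exists_poisson G C f
  obtain ⟨k, c, hk, hc⟩ := exists_poisson G C (srwStepVariance G g)
  exact ⟨c, 0, fun Ω _ P _ X hX hC => hX.hasAsymptoticVariance hC hg hk,
    fun Ω' _ P' _ X' hX' hC => hX'.hasAsymptoticVariance_zero f hC,
    hc (srwStepVariance_nonneg G g)⟩
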